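/- Words are over the alphabet $\{1,2\}$ and letters of an infinite word are numbered $n=1,2,3,\dots$. Let $\sigma_1\colon 1\mapsto 1,\ 2\mapsto 12$ and $\sigma_2\colon 1\mapsto 21,\ 2\mapsto 2$, extended to finite words by concatenation. A \emph{standard Sturmian word} is an infinite word $w$ for which there is a sequence $(s_n)_{n\ge1}$ in $\{\sigma_1,\sigma_2\}$, containing each of $\sigma_1$ and $\sigma_2$ infinitely often, such that the finite words $s_1\circ\cdots\circ s_n(1)$ and $s_1\circ\cdots\circ s_n(2)$ both converge to $w$ as $n\to\infty$ (i.e. every prefix of $w$ is a prefix of these words for all large $n$). The \emph{frequency} of the letter $a$ in $w$ is the limit, if it exists, of the proportion of letters $a$ among the first $n$ letters of $w$. For $\theta=(\theta_1,\theta_2)\in(\mathbb R_{>0})^2$ and $x\in[0,1)^2$ define the following infinite words, only positive times being considered. - $w_{\mathrm{billiard}}(x,\theta)$: a ball starts at $x$ with momentum $\theta$ on the table $[0,1]^2$, moves in straight lines and is reflected at the edges; the $n$-th letter is $1$ if the $n$-th edge hit is vertical and $2$ if it is horizontal (defined if no corner is hit at a positive time). - $w_{\mathrm{line}}(x,\theta)$: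 the $n$-th letter is $1$ if the $n$-th intersection of the half-line $\{x+t\theta : t>0\}$ with the grid $(\mathbb Z\times\mathbb R)\cup(\mathbb R\times\mathbb Z)$ is on a vertical branch $\mathbb Z\times\mathbb R$, and $2$ otherwise (defined if the half-line avoids $\mathbb Z^2$). - $w_{\mathrm{flow}}(x,\theta)$: the $n$-th letter is $1$ if the $n$-th time $t>0$ at which $x+t\theta$ in the torus $\mathbb R^2/\mathbb Z^2$ belongs to $P=\{0\}\times[0,1)\,\cup\,[0,1)\times\{0\}$, it belongs to the vertical branch $\{0\}\times[0,1)$, and $2$ otherwise (defined if the orbit avoids the point $(0,0)$ at positive times). For $y\in[0,1)$ and $\alpha\in(0,1)$, the $n$-th letter of $w_{\mathrm{rotation}}(y,\alpha)$ is $1$ if $R_\alpha^{n-1}(y)\in[0,1-\alpha)$ and $2$ otherwise, where $R_\alpha(y)=y+\alpha \bmod 1$ on $[0,1)$. \textbf{Theorem.} Let $w$ be a standard Sturmian word. Then $w$ admits letter frequencies $(f_1,f_2)$, with $f_1>0$ and $0<f_2<1$; the billiard, line and flow trajectories from the origin in direction $(f_1,f_2)$ hit no corner at a positive time; and $$w =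 w_{\mathrm{billiard}}(0,(f_1,f_2)) = w_{\mathrm{line}}(0,(f_1,f_2)) = w_{\mathrm{flow}}(0,(f_1,f_2)) = w_{\mathrm{rotation}}(f_2,f_2).$$ -/

import Mathlib

open Filter Topology

namespace Sturmian

/-- The binary alphabet `{1, 2}`. -/
inductive Letter where
  | one : Letter
  | two : Letter
  deriving DecidableEq

/-- Infinite binary words. Indices start at `0`: the value `w n` is the `(n+1)`-th letter. -/
abbrev InfWord := ℕ → Letter

/-- The prefix of length `n` of an infinite word. -/
def pref (w : InfWord) (n : ℕ) : List Letter := (List.range n).map w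

/-- The letter `a` has frequency `f` in `w`: the proportion of `a` in the prefix of length `n`
tends to `f`. -/
def HasLetterFreq (w : InfWord) (a : Letter) (f : ℝ) : Prop :=
  Tendsto (fun n : ℕ => ((pref w n).count a : ℝ) / (n : ℝ)) atTop (𝓝 f)

/-! ### Standard Sturmian words -/

/-- The substitutions `σ₁ : 1 ↦ 1, 2 ↦ 12` and `σ₂ : 1 ↦ 21, 2 ↦ 2`. -/
def sigma : Letter → Letter → List Letter
  | .one, .one => [.one]
  | .one, .two => [.one, .two]
  | .two, .one => [.two, .one]
  | .two, .two => [.two]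

/-- The morphism of finite words induced by a substitution. -/
def applySubst (σ : Letter → List Letter) (u : List Letter) : List Letter := u.flatMap σ

/-- `iterSubst s n u` is `s₁ ∘ s₂ ∘ ⋯ ∘ sₙ (u)`, where the `k`-th substitution `sₖ` is
`sigma (s (k - 1))`. -/
def iterSubst (s : ℕ → Letter) : ℕ → List Letter → List Letter
  | 0, u => u
  | n + 1, u => iterSubst s n (applySubst (sigma (s n)) u)

/-- The finite words `u n` converge to the infinite word `w`: they share larger and larger
prefixes with `w`. -/
def WordsTendsto (u : ℕ → List Letter) (w : InfWord) : Prop :=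
  ∀ N : ℕ, ∀ᶠ n in atTop, pref w N <+: u n

/-- `w` is a standard Sturmian word: for some sequence `(sₙ)` in `{σ₁, σ₂}` that contains both
substitutions infinitely often, `s₁ ∘ ⋯ ∘ sₙ (1)` and `s₁ ∘ ⋯ ∘ sₙ (2)` both converge to `w`. -/
def IsStandardSturmian (w : InfWord) : Prop :=
  ∃ s : ℕ → Letter, (∀ i : Letter, ∃ᶠ n in atTop, s n = i) ∧
    ∀ a : Letter, WordsTendsto (fun n => iterSubst s n [a]) w

/-! ### Billiard words -/

/-- The two vertical edges of the table `[0,1]²`. -/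
def verticalEdges : Set (ℝ × ℝ) := {p | (p.1 = 0 ∨ p.1 = 1) ∧ p.2 ∈ Set.Icc (0 : ℝ) 1}

/-- The two horizontal edges of the table `[0,1]²`. -/
def horizontalEdges : Set (ℝ × ℝ) := {p | p.1 ∈ Set.Icc (0 : ℝ) 1 ∧ (p.2 = 0 ∨ p.2 = 1)}

/-- The first positive time at which a ball at position `p` with momentum `v` hits an edge. -/
noncomputable def hitTime (p v : ℝ × ℝ) : ℝ :=
  sInf {t : ℝ | 0 < t ∧ p + t • v ∈ verticalEdges ∪ horizontalEdges}

open Classical in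
/-- The momentum after a bounce at the point `q` of the boundary: a vertical edge reverses the
horizontal component, a horizontal edge reverses the vertical component. -/
noncomputable def reflect (q v : ℝ × ℝ) : ℝ × ℝ :=
  (if q ∈ verticalEdges then -v.1 else v.1, if q ∈ horizontalEdges then -v.2 else v.2)

/-- From a state (position, momentum), the ball moves in a straight line until it hits an edge and
bounces there. The result is the state just after the bounce. -/
noncomputable def billiardStep (s : (ℝ × ℝ) × (ℝ × ℝ)) : (ℝ × ℝ) × (ℝ × ℝ) :=
  (s.1 + hitTime s.1 s.2 • s.2, reflect (s.1 + hitTime s.1 s.2 • s.2) s.2)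

/-- The point of the boundary at which the `(n+1)`-th hit takes place. -/
noncomputable def hitPoint (x θ : ℝ × ℝ) (n : ℕ) : ℝ × ℝ := (billiardStep^[n + 1] (x, θ)).1

/-- The billiard trajectory hits no corner of the table (at positive times). -/
def BilliardAvoidsCorners (x θ : ℝ × ℝ) : Prop :=
  ∀ n : ℕ, ¬ (hitPoint x θ n ∈ verticalEdges ∧ hitPoint x θ n ∈ horizontalEdges)

open Classical in
/-- The billiard word: the letter is `1` if the hit edge is vertical, and `2` if it is
horizontal. -/
noncomputable def billiardWord (x θ : ℝ × ℝ) : InfWord := fun n =>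
  if hitPoint x θ n ∈ verticalEdges then .one else .two

/-! ### Cutting sequences -/

/-- `t` is the `(n+1)`-th element of `T`, in increasing order. -/
def IsNth (T : Set ℝ) (n : ℕ) (t : ℝ) : Prop := t ∈ T ∧ (T ∩ Set.Iio t).encard = n

/-- The vertical branches `ℤ × ℝ` of the integer grid. -/
def gridVertical : Set (ℝ × ℝ) := {p | ∃ k : ℤ, p.1 = k}

/-- The horizontal branches `ℝ × ℤ` of the integer grid. -/
def gridHorizontal : Set (ℝ × ℝ) := {p | ∃ k : ℤ, p.2 = k}

/-- The parameters `t > 0` at which the half-line `x + tθ` meets the grid. -/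
def lineTimes (x θ : ℝ × ℝ) : Set ℝ := {t | 0 < t ∧ x + t • θ ∈ gridVertical ∪ gridHorizontal}

/-- The half-line `x + tθ`, `t > 0`, passes through no grid intersection. -/
def LineAvoidsCorners (x θ : ℝ × ℝ) : Prop :=
  ∀ t : ℝ, 0 < t → ¬ (x + t • θ ∈ gridVertical ∧ x + t • θ ∈ gridHorizontal)

open Classical in
/-- The cutting sequence of the half-line `x + tθ`, `t > 0`: the letter is `1` if the corresponding
intersection with the grid is on a vertical branch, and `2` otherwise. -/
noncomputable def lineWord (x θ : ℝ × ℝ) : InfWord := fun n =>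
  if ∃ t : ℝ, IsNth (lineTimes x θ) n t ∧ x + t • θ ∈ gridVertical then .one else .two

/-! ### Linear flow on the torus -/

/-- The torus `ℝ²/ℤ²`. -/
abbrev Torus := UnitAddCircle × UnitAddCircle

/-- The linear flow with direction `θ` on the torus. -/
noncomputable def torusFlow (θ : ℝ × ℝ) (t : ℝ) (p : Torus) : Torus :=
  (p.1 + ((t * θ.1 : ℝ) : UnitAddCircle), p.2 + ((t * θ.2 : ℝ) : UnitAddCircle))

/-- The vertical branch `{0} × [0,1)` of the Poincaré section. -/
def sectionVertical : Set Torus := {p | p.1 = 0}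

/-- The horizontal branch `[0,1) × {0}` of the Poincaré section. -/
def sectionHorizontal : Set Torus := {p | p.2 = 0}

/-- The positive times at which the orbit of `x` crosses the Poincaré section. -/
def flowTimes (x : Torus) (θ : ℝ × ℝ) : Set ℝ :=
  {t | 0 < t ∧ torusFlow θ t x ∈ sectionVertical ∪ sectionHorizontal}

/-- The orbit of `x` does not pass through the corner point `(0,0)` at positive times. -/
def FlowAvoidsCorner (x : Torus) (θ : ℝ × ℝ) : Prop :=
  ∀ t : ℝ, 0 < t → torusFlow θ t x ≠ (0, 0)

open Classical in
/-- The flow word: the letter is `1` if the corresponding crossing of the Poincaré section is via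
its vertical branch, and `2` otherwise. -/
noncomputable def flowWord (x : Torus) (θ : ℝ × ℝ) : InfWord := fun n =>
  if ∃ t : ℝ, IsNth (flowTimes x θ) n t ∧ torusFlow θ t x ∈ sectionVertical then .one else .two

/-! ### Rotations -/

/-- The rotation `y ↦ y + α mod 1` of the circle `ℝ/ℤ = [0,1)`. -/
noncomputable def rotation (α y : ℝ) : ℝ := Int.fract (y + α)

open Classical in
/-- The coding of the orbit of `y ∈ [0,1)` under the rotation by `α`: the letter is `1` if the
current point lies in `[0, 1 - α)`, and `2` otherwise. -/
noncomputable def rotationWord (y α : ℝ) : InfWord := fun n =>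
  if (rotation α)^[n] y ∈ Set.Ico 0 (1 - α) then .one else .two

end Sturmian

/-! Everything passes through the characteristic word `charWord α`, in which a letter is 2 exactly
when the floor of the multiples of `α` jumps. A standard Sturmian word is such a word for an
irrational `α` in (0,1) (`IsStandardSturmian.exists_eq_charWord`), and each of the four
constructions produces `charWord α`.

The first claim is desubstitution. Comparing densities of the letter 2, `sigma a` should send slope
`y` to `y/(1+y)` or to `1/(2-y)`; comparing floors shows that it does send prefixes of `charWord y`
to prefixes of `charWord x` (`applySubst_sigma_pref`). Compactness gives slopes compatible with the
whole directive sequence (`exists_slopes`). Since both substitutions recur, the slopes avoid 0 and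
1, and then a descent on denominators makes them irrational. The word `w` and `charWord (x 0)` thus
share arbitrarily long prefixes.

Counting 2s by telescoping floors gives the frequencies `1 - α` and `α`. With direction `(1 - α, α)`
the two coordinates at time `t` add up to `t`, so by irrationality the crossing of index `n` is the
only one in the time interval `(n+1, n+2)`, and there are none up to time 1 (`crossTime_mem_Ioo`,
`exists_eq_crossTime`). The floor at `n+1` and at `n+2` tells which branch is crossed. The torus
flow is the line modulo ℤ², and the billiard is the line folded into the unit square. -/

namespace Sturmian

/-! ### Characteristic words -/

/-- The characteristic word of slope `α`: the letter at index `n` is `1` if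
`⌊(n + 2) α⌋ = ⌊(n + 1) α⌋`, and `2` otherwise. -/
noncomputable def charWord (α : ℝ) : InfWord := fun n =>
  if ⌊((n : ℝ) + 2) * α⌋ = ⌊((n : ℝ) + 1) * α⌋ then .one else .two

theorem charWord_eq_one {α : ℝ} (h0 : 0 ≤ α) {n : ℕ} {l : ℤ} (h1 : (l : ℝ) ≤ (n + 1) * α)
    (h2 : (n + 2) * α < l + 1) : charWord α n = .one := by
  have e1 : ⌊((n : ℝ) + 2) * α⌋ = l := Int.floor_eq_iff.2 ⟨by linarith, h2⟩
  have e2 : ⌊((n : ℝ) + 1) * α⌋ = l := Int.floor_eq_iff.2 ⟨h1, by linarith⟩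
  simp [charWord, e1, e2]

theorem charWord_eq_two {α : ℝ} {n : ℕ} {l : ℤ} (h1 : (n + 1) * α < l)
    (h2 : (l : ℝ) ≤ (n + 2) * α) : charWord α n = .two := by
  have e1 : l ≤ ⌊((n : ℝ) + 2) * α⌋ := Int.le_floor.2 h2
  have e2 : ⌊((n : ℝ) + 1) * α⌋ < l := Int.floor_lt.2 h1
  simp only [charWord]
  rw [if_neg (by omega)]

theorem floor_of_charWord_eq_one {α : ℝ} {n : ℕ} (h : charWord α n = .one) :
    ⌊((n : ℝ) + 2) * α⌋ = ⌊((n : ℝ) + 1) * α⌋ := by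
  by_contra hne
  simp [charWord, hne] at h

theorem floor_of_charWord_eq_two {α : ℝ} (h0 : 0 ≤ α) (h1 : α < 1) {n : ℕ}
    (h : charWord α n = .two) :
    ⌊((n : ℝ) + 2) * α⌋ = ⌊((n : ℝ) + 1) * α⌋ + 1 := by
  have hne : ⌊((n : ℝ) + 2) * α⌋ ≠ ⌊((n : ℝ) + 1) * α⌋ := by
    intro he
    simp [charWord, he] at h
  have e1 : ⌊((n : ℝ) + 1) * α⌋ ≤ ⌊((n : ℝ) + 2) * α⌋ := Int.floor_le_floor (by linarith)
  have e2 : ⌊((n : ℝ) + 2) * α⌋ < ⌊((n : ℝ) + 1) * α⌋ + 2 := by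
    rw [Int.floor_lt]
    push_cast
    linarith [Int.lt_floor_add_one (((n : ℝ) + 1) * α)]
  omega

/-! ### Letter counts and frequencies of characteristic words. -/

theorem pref_succ (w : InfWord) (n : ℕ) : pref w (n + 1) = pref w n ++ [w n] := by
  simp [pref, List.range_succ]

@[simp]
theorem length_pref (w : InfWord) (n : ℕ) : (pref w n).length = n := by
  simp [pref]

/-- The floors telescope: each 2 is a jump by exactly one, each 1 is no jump, and the initial value
is `⌊α⌋ = 0`. -/
theorem count_two_pref_charWord {α : ℝ} (h0 : 0 ≤ α) (h1 : α < 1) (n : ℕ) :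
    (((pref (charWord α) n).count .two : ℕ) : ℤ) = ⌊((n : ℝ) + 1) * α⌋ := by
  induction n with
  | zero =>
    have : ⌊α⌋ = 0 := Int.floor_eq_iff.2 ⟨by simpa, by simpa⟩
    simp [pref, this]
  | succ n ih =>
    have e : ((n + 1 : ℕ) : ℝ) + 1 = (n : ℝ) + 2 := by push_cast; ring
    rw [pref_succ, List.count_append, e]
    push_cast
    rw [ih]
    cases h : charWord α n with
    | one => simp [floor_of_charWord_eq_one h]
    | two => simp [floor_of_charWord_eq_two h0 h1 h]

theorem count_one_add_count_two (u : List Letter) : u.count .one + u.count .two = u.length := by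
  induction u with
  | nil => rfl
  | cons a u ih => cases a <;> simp <;> omega

theorem tendsto_floor_div (α : ℝ) :
    Tendsto (fun n : ℕ => ((⌊((n : ℝ) + 1) * α⌋ : ℤ) : ℝ) / n) atTop (𝓝 α) := by
  have hlim : ∀ c : ℝ, Tendsto (fun n : ℕ => α + c / n) atTop (𝓝 α) := fun c => by
    simpa using tendsto_const_nhds.add (tendsto_const_div_atTop_nhds_zero_nat c)
  refine tendsto_of_tendsto_of_tendsto_of_le_of_le' (hlim (α - 1)) (hlim α) ?_ ?_
  · filter_upwards [eventually_gt_atTop 0] with n hn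
    have hn' : (0 : ℝ) < n := by exact_mod_cast hn
    rw [le_div_iff₀ hn', add_mul α, div_mul_cancel₀ _ hn'.ne']
    linarith [Int.lt_floor_add_one (((n : ℝ) + 1) * α)]
  · filter_upwards [eventually_gt_atTop 0] with n hn
    have hn' : (0 : ℝ) < n := by exact_mod_cast hn
    rw [div_le_iff₀ hn', add_mul α, div_mul_cancel₀ _ hn'.ne']
    linarith [Int.floor_le (((n : ℝ) + 1) * α)]

theorem hasLetterFreq_two_charWord {α : ℝ} (h0 : 0 ≤ α) (h1 : α < 1) :
    HasLetterFreq (charWord α) .two α := by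
  refine (tendsto_floor_div α).congr fun n => ?_
  rw [← count_two_pref_charWord h0 h1 n]
  simp

theorem hasLetterFreq_one_charWord {α : ℝ} (h0 : 0 ≤ α) (h1 : α < 1) :
    HasLetterFreq (charWord α) .one (1 - α) := by
  refine (tendsto_const_nhds.sub (hasLetterFreq_two_charWord h0 h1)).congr' ?_
  filter_upwards [eventually_gt_atTop 0] with n hn
  have hn' : (n : ℝ) ≠ 0 := by exact_mod_cast hn.ne'
  have h : ((((pref (charWord α) n).count .one + (pref (charWord α) n).count .two : ℕ)) : ℝ) = n := by
    rw [count_one_add_count_two, length_pref]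
  push_cast at h
  rw [eq_div_iff hn', sub_mul, div_mul_cancel₀ _ hn']
  linarith

/-! ### Desubstitution -/

/-- The relation between the slope `y` of a characteristic word and the slope `x` of its image under
the substitution `sigma a`. -/
def SlopeRel : Letter → ℝ → ℝ → Prop
  | .one, x, y => x * (1 + y) = y
  | .two, x, y => x * (2 - y) = 1

/-! ### Slopes compatible with a directive sequence. -/

theorem exists_slopeRel (a : Letter) {y : ℝ} (hy : y ∈ Set.Icc (0 : ℝ) 1) :
    ∃ x ∈ Set.Icc (0 : ℝ) 1, SlopeRel a x y := by
  obtain ⟨h0, h1⟩ := hy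
  cases a with
  | one =>
    have h : 0 < 1 + y := by linarith
    exact ⟨y / (1 + y), ⟨by positivity, (div_le_one h).2 (by linarith)⟩, div_mul_cancel₀ _ h.ne'⟩
  | two =>
    have h : 0 < 2 - y := by linarith
    exact ⟨1 / (2 - y), ⟨by positivity, (div_le_one h).2 (by linarith)⟩, div_mul_cancel₀ _ h.ne'⟩

/-- Slopes are determined backwards, `x n` by `x (n + 1)`, so a finite chain can be built from an
arbitrary last slope. The induction prepends one slope, whence the quantification over all `s`. -/
theorem exists_slopes_finite (N : ℕ) : ∀ s : ℕ → Letter, ∃ x : ℕ → ℝ,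
    (∀ n, x n ∈ Set.Icc (0 : ℝ) 1) ∧ ∀ n < N, SlopeRel (s n) (x n) (x (n + 1)) := by
  induction N with
  | zero => exact fun s => ⟨fun _ => 0, by simp, by simp⟩
  | succ N ih =>
    intro s
    obtain ⟨x, hx, hr⟩ := ih fun n => s (n + 1)
    obtain ⟨y, hy, hyr⟩ := exists_slopeRel (s 0) (hx 0)
    refine ⟨fun n => Nat.casesOn n y x, fun n => ?_, fun n hn => ?_⟩
    · cases n with
      | zero => exact hy
      | succ n => exact hx n
    · cases n with
      | zero => exact hyr
      | succ n => exact hr n (by omega)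

/-- `SlopeRel` has its denominators cleared, so both sides are polynomial in the coordinates. -/
theorem isClosed_slopeRel (a : Letter) (n : ℕ) :
    IsClosed {x : ℕ → ℝ | SlopeRel a (x n) (x (n + 1))} := by
  cases a <;> exact isClosed_eq (by fun_prop) (by fun_prop)

/-- An infinite chain has no last slope to start from. The chains satisfying the first `N` relations
form decreasing nonempty closed subsets of the compact cube, so some chain satisfies all of them. -/
theorem exists_slopes (s : ℕ → Letter) : ∃ x : ℕ → ℝ,
    (∀ n, x n ∈ Set.Icc (0 : ℝ) 1) ∧ ∀ n, SlopeRel (s n) (x n) (x (n + 1)) := by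
  let K : Set (ℕ → ℝ) := Set.univ.pi fun _ => Set.Icc 0 1
  have hK : IsCompact K := isCompact_univ_pi fun _ => isCompact_Icc
  let A : ℕ → Set (ℕ → ℝ) := fun N => K ∩ ⋂ n, ⋂ (_ : n < N), {x | SlopeRel (s n) (x n) (x (n + 1))}
  have hA : ∀ N, IsClosed (A N) := fun N => hK.isClosed.inter <|
    isClosed_iInter fun n => isClosed_iInter fun _ => isClosed_slopeRel _ _
  obtain ⟨x, hx⟩ := IsCompact.nonempty_iInter_of_sequence_nonempty_isCompact_isClosed A
    (fun N x hx => ⟨hx.1, Set.mem_iInter₂.2 fun n hn => Set.mem_iInter₂.1 hx.2 n (by omega)⟩)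
    (fun N => by
      obtain ⟨x, hx, hr⟩ := exists_slopes_finite N s
      exact ⟨x, fun n _ => hx n, Set.mem_iInter₂.2 hr⟩)
    (hK.of_isClosed_subset (hA 0) Set.inter_subset_left) hA
  rw [Set.mem_iInter] at hx
  exact ⟨x, fun n => (hx 0).1 n trivial, fun n =>
    Set.mem_iInter₂.1 (hx (n + 1)).2 n (Nat.lt_succ_self n)⟩

/-- Slope 0 is compatible only with `σ₁` and slope 1 only with `σ₂`, and each reproduces itself at
the next index. An endpoint value would make the directive sequence eventually constant. -/
theorem slope_mem_Ioo {s : ℕ → Letter} (hs : ∀ i : Letter, ∃ᶠ n in atTop, s n = i) {x : ℕ → ℝ}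
    (hx : ∀ n, x n ∈ Set.Icc (0 : ℝ) 1) (hr : ∀ n, SlopeRel (s n) (x n) (x (n + 1))) (n : ℕ) :
    x n ∈ Set.Ioo (0 : ℝ) 1 := by
  have hzero : ∀ m, x m = 0 → s m = .one ∧ x (m + 1) = 0 := fun m hm => by
    have h := hr m
    cases hsm : s m <;> simp only [hsm, SlopeRel, hm] at h
    · exact ⟨rfl, by linarith⟩
    · linarith
  have hone : ∀ m, x m = 1 → s m = .two ∧ x (m + 1) = 1 := fun m hm => by
    have h := hr m
    cases hsm : s m <;> simp only [hsm, SlopeRel, hm] at h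
    · linarith
    · exact ⟨rfl, by linarith⟩
  refine ⟨lt_of_le_of_ne (hx n).1 fun h => ?_, lt_of_le_of_ne (hx n).2 fun h => ?_⟩
  · have hall : ∀ m ≥ n, x m = 0 := fun m hm => by
      induction m, hm using Nat.le_induction with
      | base => exact h.symm
      | succ m _ ih => exact (hzero m ih).2
    obtain ⟨m, hm, hm'⟩ := frequently_atTop.1 (hs .two) n
    have := (hzero m (hall m hm)).1
    simp [hm'] at this
  · have hall : ∀ m ≥ n, x m = 1 := fun m hm => by
      induction m, hm using Nat.le_induction with
      | base => exact h
      | succ m _ ih => exact (hone m ih).2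
    obtain ⟨m, hm, hm'⟩ := frequently_atTop.1 (hs .one) n
    have := (hone m (hall m hm)).1
    simp [hm'] at this

/-- Infinite descent: if `x n = p/q` with `0 < p < q`, the next slope is `p/(q-p)` for `σ₁` and
`(2p-q)/p` for `σ₂`, with a smaller positive denominator. -/
theorem slope_mul_ne_int {s : ℕ → Letter} {x : ℕ → ℝ} (hx : ∀ n, x n ∈ Set.Ioo (0 : ℝ) 1)
    (hr : ∀ n, SlopeRel (s n) (x n) (x (n + 1))) (q : ℕ) :
    ∀ (n : ℕ) (p : ℤ), 0 < q → x n * q ≠ p := by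
  induction q using Nat.strong_induction_on with
  | _ q ih =>
    intro n p hq hp
    obtain ⟨h0, h1⟩ := hx n
    have hq' : (0 : ℝ) < q := by exact_mod_cast hq
    have hp0 : 0 < p := by
      have : (0 : ℝ) < p := by rw [← hp]; positivity
      exact_mod_cast this
    have hpq : p < q := by
      have : (p : ℝ) < q := by rw [← hp]; nlinarith
      exact_mod_cast this
    lift p to ℕ using hp0.le
    have h := hr n
    push_cast at hp
    cases hsn : s n <;> simp only [hsn, SlopeRel] at h
    · refine ih (q - p) (by omega) (n + 1) p (by omega) ?_
      rw [Nat.cast_sub (by omega)]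
      push_cast
      rw [← hp]
      linear_combination (-(q : ℝ)) * h
    · refine ih p (by omega) (n + 1) (2 * p - q) (by omega) ?_
      push_cast
      rw [← hp]
      linear_combination (-(q : ℝ)) * h

theorem irrational_slope {s : ℕ → Letter} {x : ℕ → ℝ} (hx : ∀ n, x n ∈ Set.Ioo (0 : ℝ) 1)
    (hr : ∀ n, SlopeRel (s n) (x n) (x (n + 1))) (n : ℕ) : Irrational (x n) := by
  rintro ⟨r, hrn⟩
  refine slope_mul_ne_int hx hr r.den n r.num r.den_pos ?_
  rw [← hrn]
  exact_mod_cast Rat.mul_den_eq_num r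

/-! ### Action of the substitutions on characteristic words. -/

theorem applySubst_append (σ : Letter → List Letter) (u v : List Letter) :
    applySubst σ (u ++ v) = applySubst σ u ++ applySubst σ v := by
  simp [applySubst]

theorem length_applySubst_sigma (a : Letter) (u : List Letter) :
    (applySubst (sigma a) u).length = u.length + match a with
      | .one => u.count .two
      | .two => u.count .one := by
  induction u with
  | nil => cases a <;> rfl
  | cons b u ih =>
    cases a <;> cases b <;> simp [applySubst, sigma] at ih ⊢ <;> omega

/-- The image of a prefix of length `N` containing `l` letters 2 has length `M = N + l` and still
`l` letters 2. Hence the next floor for slope `x` should be `l`, and every inequality to check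
becomes one about `l` and `(N + 1) * y` or `(N + 2) * y`. -/
theorem applySubst_sigma_one_pref {x y : ℝ} (hx0 : 0 ≤ x) (hy0 : 0 ≤ y) (hy1 : y < 1)
    (h : SlopeRel .one x y) (N : ℕ) :
    applySubst (sigma .one) (pref (charWord y) N) =
      pref (charWord x) (applySubst (sigma .one) (pref (charWord y) N)).length := by
  induction N with
  | zero => rfl
  | succ N ih =>
    have hlen := length_applySubst_sigma .one (pref (charWord y) N)
    simp only [length_pref] at hlen
    have hcount := count_two_pref_charWord hy0 hy1 N
    set l := (pref (charWord y) N).count .two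
    set M := (applySubst (sigma .one) (pref (charWord y) N)).length
    have hM : (M : ℝ) = N + l := by exact_mod_cast hlen
    obtain ⟨hl1, hl2⟩ := Int.floor_eq_iff.1 hcount.symm
    push_cast at hl1 hl2
    have hx : x = y / (1 + y) := by
      rw [eq_div_iff (by linarith)]; exact h
    have hy : 0 < 1 + y := by linarith
    -- After multiplication by `1 + y` the two bounds are `l ≤ (N + 1) * y` and `(N + 1) * y < l +
    -- 1`, which say that `l` is the floor.
    have first : charWord x M = .one := by
      refine charWord_eq_one (l := l) hx0 ?_ ?_ <;> rw [hM, hx, ← mul_div_assoc]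
      · rw [le_div_iff₀ hy]; push_cast; linarith
      · rw [div_lt_iff₀ hy]; push_cast; linarith
    rw [pref_succ, applySubst_append, List.length_append, ih]
    cases hc : charWord y N with
    | one =>
      simp [applySubst, sigma, pref_succ, first]
    | two =>
      have hfl := floor_of_charWord_eq_two hy0 hy1 hc
      rw [← hcount] at hfl
      obtain ⟨hl3, hl4⟩ := Int.floor_eq_iff.1 hfl
      push_cast at hl3 hl4
      have second : charWord x (M + 1) = .two := by
        refine charWord_eq_two (l := l + 1) ?_ ?_ <;> push_cast <;> rw [hM, hx, ← mul_div_assoc]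
        · rw [div_lt_iff₀ hy]; linarith
        · rw [le_div_iff₀ hy]; linarith
      simp [applySubst, sigma, first, second, pref_succ]

/-- Each image block contains exactly one 2, so the image of a prefix of length `N` has `N` letters
2; its length is `M = 2N - l`, one extra letter for each of the `N - l` letters 1. The next 2 is
therefore the jump of the floor from `N` to `N + 1`. -/
theorem applySubst_sigma_two_pref {x y : ℝ} (hx0 : 0 ≤ x) (hy0 : 0 ≤ y) (hy1 : y < 1)
    (h : SlopeRel .two x y) (N : ℕ) :
    applySubst (sigma .two) (pref (charWord y) N) =
      pref (charWord x) (applySubst (sigma .two) (pref (charWord y) N)).length := by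
  induction N with
  | zero => rfl
  | succ N ih =>
    have hlen := length_applySubst_sigma .two (pref (charWord y) N)
    have hsum := count_one_add_count_two (pref (charWord y) N)
    simp only [length_pref] at hlen hsum
    have hcount := count_two_pref_charWord hy0 hy1 N
    set l := (pref (charWord y) N).count .two
    set M := (applySubst (sigma .two) (pref (charWord y) N)).length
    have hM : (M : ℝ) = 2 * N - l := by
      have : M + l = 2 * N := by omega
      have : (M : ℝ) + l = 2 * N := by exact_mod_cast this
      linarith
    obtain ⟨hl1, hl2⟩ := Int.floor_eq_iff.1 hcount.symm
    push_cast at hl1 hl2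
    have hy : 0 < 2 - y := by linarith
    have hx : x = 1 / (2 - y) := by
      rw [eq_div_iff hy.ne']; exact h
    have first : charWord x M = .two := by
      refine charWord_eq_two (l := N + 1) ?_ ?_ <;> rw [hM, hx, mul_one_div]
      · rw [div_lt_iff₀ hy]; push_cast; linarith
      · rw [le_div_iff₀ hy]; push_cast; linarith
    rw [pref_succ, applySubst_append, List.length_append, ih]
    cases hc : charWord y N with
    | two =>
      simp [applySubst, sigma, pref_succ, first]
    | one =>
      have hfl := floor_of_charWord_eq_one hc
      rw [← hcount] at hfl
      obtain ⟨hl3, hl4⟩ := Int.floor_eq_iff.1 hfl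
      push_cast at hl3 hl4
      have second : charWord x (M + 1) = .one := by
        refine charWord_eq_one (l := N + 1) hx0 ?_ ?_ <;> push_cast <;> rw [hM, hx, mul_one_div]
        · rw [le_div_iff₀ hy]; linarith
        · rw [div_lt_iff₀ hy]; linarith
      simp [applySubst, sigma, first, second, pref_succ]

theorem applySubst_sigma_pref (a : Letter) {x y : ℝ} (hx0 : 0 ≤ x) (hy0 : 0 ≤ y) (hy1 : y < 1)
    (h : SlopeRel a x y) (N : ℕ) :
    ∃ L, applySubst (sigma a) (pref (charWord y) N) = pref (charWord x) L := by
  cases a with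
  | one => exact ⟨_, applySubst_sigma_one_pref hx0 hy0 hy1 h N⟩
  | two => exact ⟨_, applySubst_sigma_two_pref hx0 hy0 hy1 h N⟩

theorem iterSubst_pref {s : ℕ → Letter} {x : ℕ → ℝ} (hx : ∀ n, x n ∈ Set.Ioo (0 : ℝ) 1)
    (hr : ∀ n, SlopeRel (s n) (x n) (x (n + 1))) (n : ℕ) :
    ∀ N, ∃ L, iterSubst s n (pref (charWord (x n)) N) = pref (charWord (x 0)) L := by
  induction n with
  | zero => exact fun N => ⟨N, rfl⟩
  | succ n ih =>
    intro N
    obtain ⟨L, hL⟩ := applySubst_sigma_pref (s n) (hx n).1.le (hx (n + 1)).1.le (hx (n + 1)).2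
      (hr n) N
    rw [iterSubst, hL]
    exact ih L

theorem apply_eq_of_pref_prefix {v w : InfWord} {m L : ℕ} (h : pref w (m + 1) <+: pref v L) :
    w m = v m := by
  have hle : m + 1 ≤ L := by simpa using h.length_le
  have := h.getElem (i := m) (by simp)
  simpa [pref] using this

/-- A standard Sturmian word is a characteristic word of irrational slope. -/
theorem IsStandardSturmian.exists_eq_charWord {w : InfWord} (hw : IsStandardSturmian w) :
    ∃ α ∈ Set.Ioo (0 : ℝ) 1, Irrational α ∧ w = charWord α := by
  obtain ⟨s, hs, hlim⟩ := hw
  obtain ⟨x, hx, hr⟩ := exists_slopes s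
  have hx' := slope_mem_Ioo hs hx hr
  refine ⟨x 0, hx' 0, irrational_slope hx' hr 0, funext fun m => ?_⟩
  -- The first letter of `charWord (x n)` depends on `n`, so `n` is chosen to suit both letters
  -- before that letter is known.
  obtain ⟨n, h1, h2⟩ := ((hlim .one (m + 1)).and (hlim .two (m + 1))).exists
  have h : pref w (m + 1) <+: iterSubst s n (pref (charWord (x n)) 1) := by
    cases hc : charWord (x n) 0 with
    | one => simpa [pref, hc] using h1
    | two => simpa [pref, hc] using h2
  obtain ⟨L, hL⟩ := iterSubst_pref hx' hr n 1
  rw [hL] at h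
  exact apply_eq_of_pref_prefix h

/-! ### Rotations -/

theorem rotation_iterate (α y : ℝ) (hy : y ∈ Set.Ico (0 : ℝ) 1) (n : ℕ) :
    (rotation α)^[n] y = Int.fract (y + n * α) := by
  induction n with
  | zero => simp [Int.fract_eq_self.2 hy]
  | succ n ih =>
    rw [Function.iterate_succ_apply', ih, rotation, Int.fract_eq_fract]
    exact ⟨-⌊y + n * α⌋, by rw [Int.fract]; push_cast; ring⟩

theorem charWord_eq_rotationWord {α : ℝ} (hα : α ∈ Set.Ioo (0 : ℝ) 1) :
    charWord α = rotationWord α α := by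
  funext n
  have e : α + n * α = (n + 1) * α := by ring
  rw [rotationWord, rotation_iterate α α ⟨hα.1.le, hα.2⟩, e]
  have hfl := Int.self_sub_floor (((n : ℝ) + 1) * α)
  have hfr := Int.fract_nonneg (((n : ℝ) + 1) * α)
  split_ifs with h
  · exact charWord_eq_one hα.1.le (Int.floor_le _) (by linarith [h.2])
  · have : 1 - α ≤ Int.fract (((n : ℝ) + 1) * α) := by
      by_contra hlt
      exact h ⟨hfr, not_le.1 hlt⟩
    refine charWord_eq_two (l := ⌊((n : ℝ) + 1) * α⌋ + 1) ?_ ?_ <;> push_cast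
    · exact Int.lt_floor_add_one _
    · linarith

end Sturmian

namespace Sturmian

/-! ### Crossing times -/

/-- The number of letters `2` among the first `n` letters of `charWord α`. -/
noncomputable def twos (α : ℝ) (n : ℕ) : ℤ := ⌊((n : ℝ) + 1) * α⌋

/-- The number of letters `1` among the first `n` letters of `charWord α`. -/
noncomputable def ones (α : ℝ) (n : ℕ) : ℤ := n - twos α n

/-- The time of the crossing with index `n` of the grid by the half-line from the origin with
direction `(1 - α, α)`. -/
noncomputable def crossTime (α : ℝ) (n : ℕ) : ℝ :=
  if charWord α n = .one then (ones α n + 1) / (1 - α) else (twos α n + 1) / α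

theorem twos_succ (α : ℝ) (n : ℕ) : twos α (n + 1) = ⌊((n : ℝ) + 2) * α⌋ := by
  rw [twos]
  congr 2
  push_cast
  ring

theorem twos_succ_of_one {α : ℝ} {n : ℕ} (h : charWord α n = .one) :
    twos α (n + 1) = twos α n := by
  rw [twos_succ, floor_of_charWord_eq_one h, twos]

theorem ones_succ_of_one {α : ℝ} {n : ℕ} (h : charWord α n = .one) :
    ones α (n + 1) = ones α n + 1 := by
  rw [ones, twos_succ_of_one h, ones]
  push_cast
  ring

section

variable {α : ℝ}

theorem twos_zero (hα : α ∈ Set.Ioo (0 : ℝ) 1) : twos α 0 = 0 :=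
  Int.floor_eq_iff.2 ⟨by simpa using hα.1.le, by simpa using hα.2⟩

theorem ones_zero (hα : α ∈ Set.Ioo (0 : ℝ) 1) : ones α 0 = 0 := by
  simp [ones, twos_zero hα]

theorem twos_succ_of_two (hα : α ∈ Set.Ioo (0 : ℝ) 1) {n : ℕ} (h : charWord α n = .two) :
    twos α (n + 1) = twos α n + 1 := by
  rw [twos_succ, floor_of_charWord_eq_two hα.1.le hα.2 h, twos]

theorem ones_succ_of_two (hα : α ∈ Set.Ioo (0 : ℝ) 1) {n : ℕ} (h : charWord α n = .two) :
    ones α (n + 1) = ones α n := by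
  rw [ones, twos_succ_of_two hα h, ones]
  push_cast
  ring

theorem natCast_succ_mul_ne (hirr : Irrational α) (n : ℕ) (l : ℤ) : ((n : ℝ) + 1) * α ≠ l := by
  have h := (hirr.natCast_mul (Nat.succ_ne_zero n)).ne_int l
  push_cast at h
  exact h

theorem crossTime_mul_of_one (hα : α ∈ Set.Ioo (0 : ℝ) 1) {n : ℕ} (h : charWord α n = .one) :
    crossTime α n * (1 - α) = ones α n + 1 := by
  rw [crossTime, if_pos h, div_mul_cancel₀ _ (by linarith [hα.2])]

theorem crossTime_mul_of_two (hα : α ∈ Set.Ioo (0 : ℝ) 1) {n : ℕ} (h : charWord α n = .two) :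
    crossTime α n * α = twos α n + 1 := by
  rw [crossTime, if_neg (by simp [h]), div_mul_cancel₀ _ hα.1.ne']

/-- Multiplied by `1 - α` or `α`, the bounds say exactly that the floor stays put, or jumps, between
`(n + 1) * α` and `(n + 2) * α`. Irrationality makes them strict. Disjoint intervals for distinct
`n` then put the crossings in order. -/
theorem crossTime_mem_Ioo (hα : α ∈ Set.Ioo (0 : ℝ) 1) (hirr : Irrational α) (n : ℕ) :
    crossTime α n ∈ Set.Ioo ((n : ℝ) + 1) (n + 2) := by
  have hβ : 0 < 1 - α := by linarith [hα.2]
  have hones : (ones α n : ℝ) = n - twos α n := by simp [ones]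
  have hlt : (twos α n : ℝ) < (n + 1) * α :=
    lt_of_le_of_ne (Int.floor_le _) (natCast_succ_mul_ne hirr n _).symm
  have hlt' : ((n : ℝ) + 1) * α < twos α n + 1 := Int.lt_floor_add_one _
  cases hc : charWord α n with
  | one =>
    have hfl : ((n : ℝ) + 2) * α < twos α n + 1 := by
      rw [twos, ← floor_of_charWord_eq_one hc]
      exact Int.lt_floor_add_one _
    have hm := crossTime_mul_of_one hα hc
    constructor <;> refine lt_of_mul_lt_mul_right ?_ hβ.le <;> rw [hm] <;> linarith
  | two =>
    have hle : ((twos α n + 1 : ℤ) : ℝ) ≤ (n + 2) * α := by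
      rw [twos, ← floor_of_charWord_eq_two hα.1.le hα.2 hc]
      exact Int.floor_le _
    have hne := natCast_succ_mul_ne hirr (n + 1) (twos α n + 1)
    push_cast at hle hne
    have hlt2 := lt_of_le_of_ne hle fun h => hne (by linarith)
    have hm := crossTime_mul_of_two hα hc
    constructor <;> refine lt_of_mul_lt_mul_right ?_ hα.1.le <;> rw [hm] <;> linarith

theorem crossTime_pos (hα : α ∈ Set.Ioo (0 : ℝ) 1) (hirr : Irrational α) (n : ℕ) :
    0 < crossTime α n :=
  lt_trans (by positivity) (crossTime_mem_Ioo hα hirr n).1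

theorem strictMono_crossTime (hα : α ∈ Set.Ioo (0 : ℝ) 1) (hirr : Irrational α) :
    StrictMono (crossTime α) := by
  refine strictMono_nat_of_lt_succ fun n => ?_
  have h1 := (crossTime_mem_Ioo hα hirr n).2
  have h2 := (crossTime_mem_Ioo hα hirr (n + 1)).1
  push_cast at h2
  linarith

/-- The coordinates add up to the time, which lies in `(n + 1, n + 2)`; subtracting the integral
coordinate `ones α n + 1` locates the other one. -/
theorem crossTime_of_one (hα : α ∈ Set.Ioo (0 : ℝ) 1) (hirr : Irrational α) {n : ℕ}
    (h : charWord α n = .one) :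
    (twos α n : ℝ) < crossTime α n * α ∧ crossTime α n * α < twos α n + 1 := by
  have hm := crossTime_mul_of_one hα h
  have hones : (ones α n : ℝ) = n - twos α n := by simp [ones]
  obtain ⟨h1, h2⟩ := crossTime_mem_Ioo hα hirr n
  constructor <;> linarith

theorem crossTime_of_two (hα : α ∈ Set.Ioo (0 : ℝ) 1) (hirr : Irrational α) {n : ℕ}
    (h : charWord α n = .two) :
    (ones α n : ℝ) < crossTime α n * (1 - α) ∧ crossTime α n * (1 - α) < ones α n + 1 := by
  have hm := crossTime_mul_of_two hα h
  have hones : (ones α n : ℝ) = n - twos α n := by simp [ones]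
  obtain ⟨h1, h2⟩ := crossTime_mem_Ioo hα hirr n
  constructor <;> linarith

/-- The sum of the coordinates is `t`, so `t` would be a nonzero integer with `t * α` an integer. -/
theorem not_both_int (hirr : Irrational α) {t : ℝ} (ht : 0 < t) {k l : ℤ}
    (h1 : t * (1 - α) = k) (h2 : t * α = l) : False := by
  have h : t = ((k + l : ℤ) : ℝ) := by push_cast; linarith
  have hkl : k + l ≠ 0 := by
    rintro h0
    rw [h0] at h
    simp [h] at ht
  rw [h] at h2
  exact (hirr.intCast_mul hkl).ne_int l h2

/-- A crossing time is never an integer and is at least 1, so `n` is read off from `⌊t⌋ = n + 1`.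
The position of `t` between `n + 1` and `n + 2` then forces both the letter at `n` and the value of
`twos α n`, hence `t`. -/
theorem exists_eq_crossTime (hα : α ∈ Set.Ioo (0 : ℝ) 1) (hirr : Irrational α) {t : ℝ}
    (ht : 0 < t) (h : (∃ k : ℤ, t * (1 - α) = k) ∨ ∃ l : ℤ, t * α = l) :
    ∃ n, t = crossTime α n := by
  obtain ⟨h0, h1⟩ := hα
  have hβ : 0 < 1 - α := by linarith
  have hnot : ∀ m : ℤ, t ≠ m := by
    rintro m rfl
    rcases h with ⟨k, hk⟩ | ⟨l, hl⟩
    · exact not_both_int hirr ht hk (l := m - k) (by push_cast; linarith)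
    · exact not_both_int hirr ht (k := m - l) (by push_cast; linarith) hl
  have hone : 1 ≤ t := by
    rcases h with ⟨k, hk⟩ | ⟨k, hk⟩
    all_goals
      have hk0 : (0 : ℝ) < k := by rw [← hk]; positivity
      have hk1 : (1 : ℝ) ≤ k := by exact_mod_cast hk0
      nlinarith
  have hfl : 1 ≤ ⌊t⌋ := Int.le_floor.2 (by simpa using hone)
  obtain ⟨n, hn⟩ : ∃ n : ℕ, ⌊t⌋ = n + 1 := ⟨(⌊t⌋ - 1).toNat, by omega⟩
  obtain ⟨hn1, hn2⟩ := Int.floor_eq_iff.1 hn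
  push_cast at hn1 hn2
  refine ⟨n, ?_⟩
  rcases h with ⟨k, hk⟩ | ⟨k, hk⟩
  · have ha : (((n + 1 - k : ℤ)) : ℝ) ≤ (n + 1) * α := by
      push_cast
      nlinarith
    have hb : ((n : ℝ) + 2) * α < ((n + 1 - k : ℤ) : ℝ) + 1 := by
      push_cast
      nlinarith
    have hc := charWord_eq_one h0.le ha hb
    have htw : twos α n = n + 1 - k := Int.floor_eq_iff.2 ⟨ha, by linarith⟩
    have hm := crossTime_mul_of_one ⟨h0, h1⟩ hc
    rw [ones, htw] at hm
    push_cast at hm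
    exact mul_right_cancel₀ hβ.ne' (by linarith)
  -- A jump requires strict inequality at its left end, which is where `t ≠ n + 1` is needed.
  · have ha : ((n : ℝ) + 1) * α < k := by
      rw [← hk]
      refine mul_lt_mul_of_pos_right (lt_of_le_of_ne hn1 fun he => hnot (n + 1) ?_) h0
      push_cast
      exact he.symm
    have hb : (k : ℝ) ≤ (n + 2) * α := by nlinarith
    have hc := charWord_eq_two ha hb
    have htw : twos α n = k - 1 := Int.floor_eq_iff.2 (by push_cast; constructor <;> linarith)
    have hm := crossTime_mul_of_two ⟨h0, h1⟩ hc
    rw [htw] at hm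
    push_cast at hm
    exact mul_right_cancel₀ h0.ne' (by linarith)

end

/-! ### Cutting sequences -/

/-- For a strictly increasing `τ`, the values below `τ m` are those at the `m` indices before `m`.
-/
theorem isNth_range_iff {τ : ℕ → ℝ} (hτ : StrictMono τ) {n : ℕ} {t : ℝ} :
    IsNth (Set.range τ) n t ↔ t = τ n := by
  have key : ∀ m, (Set.range τ ∩ Set.Iio (τ m)).encard = m := fun m => by
    have : Set.range τ ∩ Set.Iio (τ m) = τ '' (Finset.range m : Set ℕ) := by
      ext u
      constructor
      · rintro ⟨⟨i, rfl⟩, hi⟩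
        exact ⟨i, by simpa using hτ.lt_iff_lt.1 hi, rfl⟩
      · rintro ⟨i, hi, rfl⟩
        exact ⟨⟨i, rfl⟩, hτ (by simpa using hi)⟩
    rw [this, hτ.injective.encard_image, Set.encard_coe_eq_coe_finsetCard, Finset.card_range]
  constructor
  · rintro ⟨⟨m, rfl⟩, hm⟩
    rw [key] at hm
    rw [Nat.cast_inj.1 hm]
  · rintro rfl
    exact ⟨⟨n, rfl⟩, key n⟩

theorem line_mem_gridVertical (v : ℝ × ℝ) (t : ℝ) :
    ((0, 0) : ℝ × ℝ) + t • v ∈ gridVertical ↔ ∃ k : ℤ, t * v.1 = k := by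
  simp [gridVertical]

theorem line_mem_gridHorizontal (v : ℝ × ℝ) (t : ℝ) :
    ((0, 0) : ℝ × ℝ) + t • v ∈ gridHorizontal ↔ ∃ k : ℤ, t * v.2 = k := by
  simp [gridHorizontal]

theorem unitAddCircle_coe_eq_zero (r : ℝ) : (r : UnitAddCircle) = 0 ↔ ∃ k : ℤ, r = k := by
  rw [AddCircle.coe_eq_zero_iff]
  simp [eq_comm]

theorem flow_mem_sectionVertical (v : ℝ × ℝ) (t : ℝ) :
    torusFlow v t (0, 0) ∈ sectionVertical ↔ ∃ k : ℤ, t * v.1 = k := by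
  simp only [torusFlow, sectionVertical, Set.mem_ofPred_eq, zero_add, unitAddCircle_coe_eq_zero]

theorem flow_mem_sectionHorizontal (v : ℝ × ℝ) (t : ℝ) :
    torusFlow v t (0, 0) ∈ sectionHorizontal ↔ ∃ k : ℤ, t * v.2 = k := by
  simp only [torusFlow, sectionHorizontal, Set.mem_ofPred_eq, zero_add, unitAddCircle_coe_eq_zero]

theorem flowTimes_zero (v : ℝ × ℝ) : flowTimes (0, 0) v = lineTimes (0, 0) v := by
  ext t
  simp only [flowTimes, lineTimes, Set.mem_ofPred_eq, Set.mem_union, flow_mem_sectionVertical,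
    flow_mem_sectionHorizontal, line_mem_gridVertical, line_mem_gridHorizontal]

theorem flowWord_zero (v : ℝ × ℝ) : flowWord (0, 0) v = lineWord (0, 0) v := by
  funext n
  classical
  refine if_congr (exists_congr fun t => ?_) rfl rfl
  rw [flowTimes_zero, flow_mem_sectionVertical, line_mem_gridVertical]

theorem crossTime_mem_vertical_iff {α : ℝ} (hα : α ∈ Set.Ioo (0 : ℝ) 1) (hirr : Irrational α)
    (n : ℕ) : (∃ k : ℤ, crossTime α n * (1 - α) = k) ↔ charWord α n = .one := by
  constructor
  · rintro ⟨k, hk⟩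
    cases hc : charWord α n with
    | one => rfl
    | two =>
      refine (not_both_int hirr (crossTime_pos hα hirr n) hk (l := twos α n + 1) ?_).elim
      push_cast
      exact crossTime_mul_of_two hα hc
  · exact fun hc => ⟨ones α n + 1, by push_cast; exact crossTime_mul_of_one hα hc⟩

theorem lineTimes_eq_range {α : ℝ} (hα : α ∈ Set.Ioo (0 : ℝ) 1) (hirr : Irrational α) :
    lineTimes (0, 0) (1 - α, α) = Set.range (crossTime α) := by
  ext t
  simp only [lineTimes, Set.mem_ofPred_eq, Set.mem_union, line_mem_gridVertical,
    line_mem_gridHorizontal]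
  constructor
  · rintro ⟨ht, h⟩
    obtain ⟨n, rfl⟩ := exists_eq_crossTime hα hirr ht h
    exact ⟨n, rfl⟩
  · rintro ⟨n, rfl⟩
    refine ⟨crossTime_pos hα hirr n, ?_⟩
    cases hc : charWord α n with
    | one => exact .inl ((crossTime_mem_vertical_iff hα hirr n).2 hc)
    | two => exact .inr ⟨twos α n + 1, by push_cast; exact crossTime_mul_of_two hα hc⟩

theorem charWord_eq_lineWord {α : ℝ} (hα : α ∈ Set.Ioo (0 : ℝ) 1) (hirr : Irrational α) :
    charWord α = lineWord (0, 0) (1 - α, α) := by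
  funext n
  simp only [lineWord, lineTimes_eq_range hα hirr, isNth_range_iff (strictMono_crossTime hα hirr),
    line_mem_gridVertical, exists_eq_left, crossTime_mem_vertical_iff hα hirr]
  cases charWord α n <;> simp

theorem lineAvoidsCorners_zero {α : ℝ} (hirr : Irrational α) :
    LineAvoidsCorners (0, 0) (1 - α, α) := by
  rintro t ht ⟨h1, h2⟩
  obtain ⟨k, hk⟩ := (line_mem_gridVertical _ _).1 h1
  obtain ⟨l, hl⟩ := (line_mem_gridHorizontal _ _).1 h2
  exact not_both_int hirr ht hk hl

theorem flowAvoidsCorner_zero {α : ℝ} (hirr : Irrational α) :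
    FlowAvoidsCorner (0, 0) (1 - α, α) := by
  intro t ht h
  obtain ⟨k, hk⟩ := (flow_mem_sectionVertical (1 - α, α) t).1 (congrArg Prod.fst h)
  obtain ⟨l, hl⟩ := (flow_mem_sectionHorizontal (1 - α, α) t).1 (congrArg Prod.snd h)
  exact not_both_int hirr ht hk hl

/-! ### Billiards -/

/-- The coordinate on `[0, 1]` obtained by folding `x`, for `x` in `[k, k + 1]`. -/
noncomputable def foldPos (k : ℤ) (x : ℝ) : ℝ := if Even k then x - k else k + 1 - x

/-- The velocity of the folded coordinate when the unfolded one moves in `[k, k + 1]` with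
velocity `v`. -/
noncomputable def foldVel (k : ℤ) (v : ℝ) : ℝ := if Even k then v else -v

theorem foldPos_add (k : ℤ) (t s v : ℝ) :
    foldPos k (t * v) + s * foldVel k v = foldPos k ((t + s) * v) := by
  unfold foldPos foldVel
  split_ifs <;> ring

theorem foldPos_mem_Ioo {k : ℤ} {x : ℝ} (h1 : k < x) (h2 : x < k + 1) :
    foldPos k x ∈ Set.Ioo (0 : ℝ) 1 := by
  unfold foldPos
  split_ifs <;> constructor <;> linarith

/-- The foldings of adjacent cells agree on their common wall, while `foldVel` changes sign there:
this is the reflection law. -/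
theorem foldPos_succ {k : ℤ} {x : ℝ} (h : x = k + 1) : foldPos (k + 1) x = foldPos k x := by
  unfold foldPos
  by_cases hk : Even k <;> simp [hk, h]

theorem foldPos_succ_eq {k : ℤ} {x : ℝ} (h : x = k + 1) :
    foldPos k x = 0 ∨ foldPos k x = 1 := by
  unfold foldPos
  by_cases hk : Even k <;> simp [hk, h]

theorem foldVel_succ (k : ℤ) (v : ℝ) : foldVel (k + 1) v = -foldVel k v := by
  unfold foldVel
  by_cases hk : Even k <;> simp [hk]

/-- The state at time `t` of the ball whose unfolded trajectory starts at the origin with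
momentum `v`, when the unfolded position is in the cell with lower left corner `(k, l)`. -/
noncomputable def foldState (v : ℝ × ℝ) (k l : ℤ) (t : ℝ) : (ℝ × ℝ) × (ℝ × ℝ) :=
  ((foldPos k (t * v.1), foldPos l (t * v.2)), (foldVel k v.1, foldVel l v.2))

theorem foldState_move (v : ℝ × ℝ) (k l : ℤ) (t s : ℝ) :
    (foldState v k l t).1 + s • (foldState v k l t).2 = (foldState v k l (t + s)).1 := by
  ext <;> simp [foldState, foldPos_add]

theorem mem_verticalEdges_of {p : ℝ × ℝ} (h1 : p.1 = 0 ∨ p.1 = 1) (h2 : p.2 ∈ Set.Ioo (0 : ℝ) 1) :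
    p ∈ verticalEdges ∧ p ∉ horizontalEdges :=
  ⟨⟨h1, Set.Ioo_subset_Icc_self h2⟩, fun h => h.2.elim h2.1.ne' h2.2.ne⟩

theorem mem_horizontalEdges_of {p : ℝ × ℝ} (h1 : p.1 ∈ Set.Ioo (0 : ℝ) 1)
    (h2 : p.2 = 0 ∨ p.2 = 1) : p ∈ horizontalEdges ∧ p ∉ verticalEdges :=
  ⟨⟨Set.Ioo_subset_Icc_self h1, h2⟩, fun h => h.1.elim h1.1.ne' h1.2.ne⟩

/-- Strictly between `t` and `t'` the unfolded point is inside the open cell, so the folded one is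
inside the open square and meets no edge. -/
theorem hitTime_foldState {v : ℝ × ℝ} (hv1 : 0 < v.1) (hv2 : 0 < v.2) {k l : ℤ} {t t' : ℝ}
    (ht : t < t') (hk : k ≤ t * v.1) (hl : l ≤ t * v.2) (hk' : t' * v.1 ≤ k + 1)
    (hl' : t' * v.2 ≤ l + 1)
    (hhit : (foldState v k l t').1 ∈ verticalEdges ∪ horizontalEdges) :
    hitTime (foldState v k l t).1 (foldState v k l t).2 = t' - t := by
  refine IsLeast.csInf_eq ⟨⟨by linarith, ?_⟩, ?_⟩
  · rwa [foldState_move, add_sub_cancel]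
  · rintro s ⟨hs, hmem⟩
    by_contra! hlt
    rw [foldState_move] at hmem
    have h1 : foldPos k ((t + s) * v.1) ∈ Set.Ioo (0 : ℝ) 1 :=
      foldPos_mem_Ioo (by nlinarith) (by nlinarith)
    have h2 : foldPos l ((t + s) * v.2) ∈ Set.Ioo (0 : ℝ) 1 :=
      foldPos_mem_Ioo (by nlinarith) (by nlinarith)
    rcases hmem with ⟨h | h, -⟩ | ⟨-, h | h⟩
    · exact h1.1.ne' h
    · exact h1.2.ne h
    · exact h2.1.ne' h
    · exact h2.2.ne h

theorem billiardStep_vertical {v : ℝ × ℝ} (hv1 : 0 < v.1) (hv2 : 0 < v.2) {k l : ℤ} {t t' : ℝ}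
    (ht : t < t') (hk : k ≤ t * v.1) (hl : l ≤ t * v.2) (hk' : t' * v.1 = k + 1)
    (h1 : l < t' * v.2) (h2 : t' * v.2 < l + 1) :
    billiardStep (foldState v k l t) = foldState v (k + 1) l t' ∧
      (foldState v (k + 1) l t').1 ∈ verticalEdges ∧
      (foldState v (k + 1) l t').1 ∉ horizontalEdges := by
  have hpos : (foldState v (k + 1) l t').1 = (foldState v k l t').1 := by
    simp [foldState, foldPos_succ hk']
  have hmem : (foldState v k l t').1 ∈ verticalEdges ∧ (foldState v k l t').1 ∉ horizontalEdges :=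
    mem_verticalEdges_of (foldPos_succ_eq hk') (foldPos_mem_Ioo h1 h2)
  rw [hpos]
  refine ⟨?_, hmem⟩
  rw [billiardStep, hitTime_foldState hv1 hv2 ht hk hl hk'.le h2.le (.inl hmem.1), foldState_move,
    add_sub_cancel, reflect, if_pos hmem.1, if_neg hmem.2]
  exact Prod.ext hpos.symm (Prod.ext (foldVel_succ _ _).symm rfl)

theorem billiardStep_horizontal {v : ℝ × ℝ} (hv1 : 0 < v.1) (hv2 : 0 < v.2) {k l : ℤ} {t t' : ℝ}
    (ht : t < t') (hk : k ≤ t * v.1) (hl : l ≤ t * v.2) (hl' : t' * v.2 = l + 1)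
    (h1 : k < t' * v.1) (h2 : t' * v.1 < k + 1) :
    billiardStep (foldState v k l t) = foldState v k (l + 1) t' ∧
      (foldState v k (l + 1) t').1 ∈ horizontalEdges ∧
      (foldState v k (l + 1) t').1 ∉ verticalEdges := by
  have hpos : (foldState v k (l + 1) t').1 = (foldState v k l t').1 := by
    simp [foldState, foldPos_succ hl']
  have hmem : (foldState v k l t').1 ∈ horizontalEdges ∧ (foldState v k l t').1 ∉ verticalEdges :=
    mem_horizontalEdges_of (foldPos_mem_Ioo h1 h2) (foldPos_succ_eq hl')
  rw [hpos]
  refine ⟨?_, hmem⟩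
  rw [billiardStep, hitTime_foldState hv1 hv2 ht hk hl h2.le hl'.le (.inr hmem.1), foldState_move,
    add_sub_cancel, reflect, if_neg hmem.2, if_pos hmem.1]
  exact Prod.ext hpos.symm (Prod.ext rfl (foldVel_succ _ _).symm)

/-- The time of the `n`-th hit, with the start of the trajectory as the hit number `0`. -/
noncomputable def startTime (α : ℝ) : ℕ → ℝ
  | 0 => 0
  | n + 1 => crossTime α n

/-- The state of the ball in the trajectory of slope `α` just after the `n`-th hit. -/
noncomputable def hitState (α : ℝ) (n : ℕ) : (ℝ × ℝ) × (ℝ × ℝ) :=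
  foldState (1 - α, α) (ones α n) (twos α n) (startTime α n)

theorem startTime_lt {α : ℝ} (hα : α ∈ Set.Ioo (0 : ℝ) 1) (hirr : Irrational α) (n : ℕ) :
    startTime α n < crossTime α n := by
  cases n with
  | zero => exact crossTime_pos hα hirr 0
  | succ n => exact strictMono_crossTime hα hirr (Nat.lt_succ_self n)

/-- Just after a hit the unfolded point lies on the wall it has crossed, and at the start it is the
corner of its cell, so only weak inequalities hold. -/
theorem le_startTime_mul {α : ℝ} (hα : α ∈ Set.Ioo (0 : ℝ) 1) (hirr : Irrational α) (n : ℕ) :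
    (ones α n : ℝ) ≤ startTime α n * (1 - α) ∧ (twos α n : ℝ) ≤ startTime α n * α := by
  cases n with
  | zero => simp [startTime, ones_zero hα, twos_zero hα]
  | succ n =>
    rw [startTime]
    cases hc : charWord α n with
    | one =>
      rw [ones_succ_of_one hc, twos_succ_of_one hc, crossTime_mul_of_one hα hc]
      exact ⟨by push_cast; exact le_rfl, (crossTime_of_one hα hirr hc).1.le⟩
    | two =>
      rw [ones_succ_of_two hα hc, twos_succ_of_two hα hc, crossTime_mul_of_two hα hc]
      exact ⟨(crossTime_of_two hα hirr hc).1.le, by push_cast; exact le_rfl⟩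

theorem billiardStep_hitState_of_one {α : ℝ} (hα : α ∈ Set.Ioo (0 : ℝ) 1) (hirr : Irrational α)
    {n : ℕ} (hc : charWord α n = .one) :
    billiardStep (hitState α n) = hitState α (n + 1) ∧
      (hitState α (n + 1)).1 ∈ verticalEdges ∧ (hitState α (n + 1)).1 ∉ horizontalEdges := by
  have hle := le_startTime_mul hα hirr n
  have h := crossTime_of_one hα hirr hc
  rw [hitState, hitState, ones_succ_of_one hc, twos_succ_of_one hc]
  exact billiardStep_vertical (v := (1 - α, α)) (sub_pos.2 hα.2) hα.1 (startTime_lt hα hirr n)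
    hle.1 hle.2 (crossTime_mul_of_one hα hc) h.1 h.2

theorem billiardStep_hitState_of_two {α : ℝ} (hα : α ∈ Set.Ioo (0 : ℝ) 1) (hirr : Irrational α)
    {n : ℕ} (hc : charWord α n = .two) :
    billiardStep (hitState α n) = hitState α (n + 1) ∧
      (hitState α (n + 1)).1 ∈ horizontalEdges ∧ (hitState α (n + 1)).1 ∉ verticalEdges := by
  have hle := le_startTime_mul hα hirr n
  have h := crossTime_of_two hα hirr hc
  rw [hitState, hitState, ones_succ_of_two hα hc, twos_succ_of_two hα hc]
  exact billiardStep_horizontal (v := (1 - α, α)) (sub_pos.2 hα.2) hα.1 (startTime_lt hα hirr n)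
    hle.1 hle.2 (crossTime_mul_of_two hα hc) h.1 h.2

theorem billiardStep_iterate {α : ℝ} (hα : α ∈ Set.Ioo (0 : ℝ) 1) (hirr : Irrational α) (n : ℕ) :
    billiardStep^[n] ((0, 0), (1 - α, α)) = hitState α n := by
  induction n with
  | zero =>
    simp [hitState, foldState, startTime, ones_zero hα, twos_zero hα, foldPos, foldVel]
  | succ n ih =>
    rw [Function.iterate_succ_apply', ih]
    cases hc : charWord α n with
    | one => exact (billiardStep_hitState_of_one hα hirr hc).1
    | two => exact (billiardStep_hitState_of_two hα hirr hc).1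

theorem billiardAvoidsCorners_zero {α : ℝ} (hα : α ∈ Set.Ioo (0 : ℝ) 1) (hirr : Irrational α) :
    BilliardAvoidsCorners (0, 0) (1 - α, α) := by
  intro n
  rw [hitPoint, billiardStep_iterate hα hirr]
  rintro ⟨h1, h2⟩
  cases hc : charWord α n with
  | one => exact (billiardStep_hitState_of_one hα hirr hc).2.2 h2
  | two => exact (billiardStep_hitState_of_two hα hirr hc).2.2 h1

theorem charWord_eq_billiardWord {α : ℝ} (hα : α ∈ Set.Ioo (0 : ℝ) 1) (hirr : Irrational α) :
    charWord α = billiardWord (0, 0) (1 - α, α) := by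
  funext n
  rw [billiardWord, hitPoint, billiardStep_iterate hα hirr]
  cases hc : charWord α n with
  | one => rw [if_pos (billiardStep_hitState_of_one hα hirr hc).2.1]
  | two => rw [if_neg (billiardStep_hitState_of_two hα hirr hc).2.2]

end Sturmian

theorem mainTheorem10 (w : Sturmian.InfWord) (hw : Sturmian.IsStandardSturmian w) :
    (∃ f₁ f₂ : ℝ, Sturmian.HasLetterFreq w .one f₁ ∧ Sturmian.HasLetterFreq w .two f₂) ∧
    ∀ f₁ f₂ : ℝ, Sturmian.HasLetterFreq w .one f₁ → Sturmian.HasLetterFreq w .two f₂ →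
      (0 < f₁ ∧ 0 < f₂ ∧ f₂ < 1) ∧
      (Sturmian.BilliardAvoidsCorners (0, 0) (f₁, f₂) ∧
        w = Sturmian.billiardWord (0, 0) (f₁, f₂)) ∧
      (Sturmian.LineAvoidsCorners (0, 0) (f₁, f₂) ∧
        w = Sturmian.lineWord (0, 0) (f₁, f₂)) ∧
      (Sturmian.FlowAvoidsCorner (0, 0) (f₁, f₂) ∧
        w = Sturmian.flowWord (0, 0) (f₁, f₂)) ∧
      w = Sturmian.rotationWord f₂ f₂ := by
  obtain ⟨α, hα, hirr, rfl⟩ := hw.exists_eq_charWord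
  have hone := Sturmian.hasLetterFreq_one_charWord hα.1.le hα.2
  have htwo := Sturmian.hasLetterFreq_two_charWord hα.1.le hα.2
  refine ⟨⟨1 - α, α, hone, htwo⟩, fun f₁ f₂ h1 h2 => ?_⟩
  -- Limits are unique, so any frequencies of `w` are the computed ones.
  obtain rfl : f₁ = 1 - α := tendsto_nhds_unique h1 hone
  obtain rfl : f₂ = α := tendsto_nhds_unique h2 htwo
  have hline := Sturmian.charWord_eq_lineWord hα hirr
  exact ⟨⟨sub_pos.2 hα.2, hα⟩,
    ⟨Sturmian.billiardAvoidsCorners_zero hα hirr, Sturmian.charWord_eq_billiardWord hα hirr⟩,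
    ⟨Sturmian.lineAvoidsCorners_zero hirr, hline⟩,
    ⟨Sturmian.flowAvoidsCorner_zero hirr, hline.trans (Sturmian.flowWord_zero _).symm⟩,
    Sturmian.charWord_eq_rotationWord hα⟩
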